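/- Fix Nakagami shape parameters $m_1,m_2>0$ and a mean square $\Omega>0$. For $j\in\{1,2\}$ let the fading power $N_j^2$ have density $$f_{N_j^2}(x)=\frac{m_j^{m_j}x^{m_j-1}}{\Omega^{m_j}\Gamma(m_j)}e^{-m_jx/\Omega},\qquad x>0 .$$ The inverse-gamma law with shape $\alpha>1$ and scale $g>0$ has density $\frac{g^{\alpha}}{\Gamma(\alpha)y^{\alpha+1}}e^{-g/y}$, $y>0$. The outage probability of an SNR $X$ at threshold $\gamma$ is $\Pr\{X\le\gamma\}=F_X(\gamma)$, the value at $\gamma$ of its CDF. For $z>0$, $G^{m,n}_{p,q}(z\,|\,a_1,\dots,a_p;b_1,\dots,b_q)$ is Meijer's function $$\frac1{2\pi i}\int_{\sigma-i\infty}^{\sigma+i\infty}\frac{\prod_{j=1}^m\Gamma(b_j-s)\prod_{j=1}^n\Gamma(1-a_j+s)}{\prod_{j=m+1}^q\Gamma(1-b_j+s)\prod_{j=n+1}^p\Gamma(a_j-s)}\,z^s\,ds ,$$ the line $\operatorname{Re}s=\sigma$ having the poles of $\Gamma(b_j-s)$, $j\le m$, on its right and those of $\Gamma(1-a_j+s)$,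 $j\le n$, on its left. (Double shadowing.) Let $I_1,I_2$ have inverse-gamma laws with shapes $\alpha_1,\alpha_2>1$ and scales $\bar\gamma_1,\bar\gamma_2>0$. Assume that $N_j^2$ and $I_j$ are independent for $j=1,2$ and that $M_1=N_1^2I_1$ and $M_2=N_2^2I_2$ are independent (for instance, that $N_1,N_2,I_1,I_2$ are independent). Then for every $\gamma>0$ the CDF, i.e. the outage probability, of the SNR $M_1M_2$ is $$F(\gamma)=\frac{1}{\Gamma(m_1)\Gamma(m_2)\Gamma(\alpha_1)\Gamma(\alpha_2)}\,G^{2,3}_{3,3}\bigl(\tilde\gamma\gamma\,\big|\,1-\alpha_2,1-\alpha_1,1;\,m_1,m_2,0\bigr),\qquad \tilde\gamma=\frac{m_1m_2}{\bar\gamma},\quad \bar\gamma=\Omega^2\bar\gamma_1\bar\gamma_2 .$$ (Single shadowing.) Let $I$ have the inverse-gamma law with shape $\alpha>1$ and scale $g>0$. Assume that $N_1^2$ and $N_2^2$ are independent and that $(N_1N_2)^2$ and $I$ are independent. Then for every $\gamma>0$ the CDF, i.e. the outage probability, of the SNR $(N_1N_2)^2I$ is $$F(\gamma)=\frac{1}{\Gamma(m_1)\Gamma(m_2)\Gamma(\alpha)}\,G^{2,2}_{2,3}\bigl(\tilde\gamma\gamma\,\big|\,1-\alpha,1;\,m_1,m_2,0\bigr),\qquad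 \tilde\gamma=\frac{m_1m_2}{\bar\gamma},\quad \bar\gamma=\Omega^2g .$$ In both cases separating lines exist, the integral converges absolutely on each of them, and its value does not depend on the line. -/

import Mathlib

namespace ShadowedScattering

open MeasureTheory ProbabilityTheory

/-- The density of the squared Nakagami-`m` envelope with shape `m` and mean square `Ω`:
`m ^ m * x ^ (m - 1) / (Ω ^ m * Γ(m)) * exp (-m x / Ω)` on `x > 0`, and `0` elsewhere. -/
noncomputable def nakagamiSqPDFReal (m Ω x : ℝ) : ℝ :=
  if 0 < x then
    m ^ m * x ^ (m - 1) / (Ω ^ m * Real.Gamma m) * Real.exp (-(m * x / Ω))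
  else 0

/-- The law on `ℝ` of the squared Nakagami-`m` envelope. -/
noncomputable def nakagamiSqMeasure (m Ω : ℝ) : Measure ℝ :=
  volume.withDensity fun x => ENNReal.ofReal (nakagamiSqPDFReal m Ω x)

/-- The law of the squared Nakagami-`m` envelope is the gamma law of shape `m`, rate `m / Ω`. -/
theorem nakagamiSqMeasure_eq_gammaMeasure {m Ω : ℝ} (hm : 0 < m) (hΩ : 0 < Ω) :
    nakagamiSqMeasure m Ω = gammaMeasure m (m / Ω) := by
  unfold nakagamiSqMeasure gammaMeasure
  refine withDensity_congr_ae ?_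
  have h0 : ∀ᵐ x : ℝ, x ≠ 0 := by simp [ae_iff]
  filter_upwards [h0] with x hx
  unfold gammaPDF nakagamiSqPDFReal gammaPDFReal
  congr 1
  rcases lt_or_gt_of_ne hx with h | h
  · rw [if_neg (not_lt.mpr h.le), if_neg (not_le.mpr h)]
  · rw [if_pos h, if_pos h.le, Real.div_rpow hm.le hΩ.le,
      show m / Ω * x = m * x / Ω by ring]
    have h1 : Ω ^ m ≠ 0 := (Real.rpow_pos_of_pos hΩ m).ne'
    have h2 : Real.Gamma m ≠ 0 := (Real.Gamma_pos_of_pos hm).ne'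
    field_simp

/-- The inverse-gamma density with shape `α` and scale `g`:
`g ^ α / (Γ(α) * y ^ (α + 1)) * exp (-g / y)` on `y > 0`, and `0` elsewhere. -/
noncomputable def invGammaPDFReal (α g y : ℝ) : ℝ :=
  if 0 < y then
    g ^ α / (Real.Gamma α * y ^ (α + 1)) * Real.exp (-(g / y))
  else 0

/-- The inverse-gamma law on `ℝ` with shape `α` and scale `g`. -/
noncomputable def invGammaMeasure (α g : ℝ) : Measure ℝ :=
  volume.withDensity fun y => ENNReal.ofReal (invGammaPDFReal α g y)

/-- The outage probability at the threshold `γT` of a random SNR `X`. -/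
noncomputable def outageProbability {S : Type*} [MeasurableSpace S] (P : Measure S)
    (X : S → ℝ) (γT : ℝ) : ℝ :=
  P.real {ω | X ω ≤ γT}

/-- The Mellin-Barnes integrand of the Meijer function `G^{m,n}_{p,q}(z | a; b)`,
`∏_{j ≤ m} Γ(b_j - s) ∏_{j ≤ n} Γ(1 - a_j + s) z ^ s /
  (∏_{j > m} Γ(1 - b_j + s) ∏_{j > n} Γ(a_j - s))`
(here the indices `j` start from `0`; `Complex.Gamma` vanishes at its poles, so that the
inverses below are the values of the entire function `1 / Γ` everywhere). -/
noncomputable def meijerIntegrand (m n : ℕ) {p q : ℕ} (a : Fin p → ℂ) (b : Fin q → ℂ)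
    (z s : ℂ) : ℂ :=
  (∏ j : Fin q, if j.val < m then Complex.Gamma (b j - s) else (Complex.Gamma (1 - b j + s))⁻¹) *
  (∏ j : Fin p, if j.val < n then Complex.Gamma (1 - a j + s) else (Complex.Gamma (a j - s))⁻¹) *
  z ^ s

/-- The vertical line `Re s = σ` separates the poles of `Γ(b_j - s)`, `j ≤ m`, which lie on
its right, from those of `Γ(1 - a_j + s)`, `j ≤ n`, which lie on its left. -/
def MeijerSeparates (m n : ℕ) {p q : ℕ} (a : Fin p → ℂ) (b : Fin q → ℂ) (σ : ℝ) : Prop :=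
  (∀ j : Fin q, j.val < m → σ < (b j).re) ∧ (∀ j : Fin p, j.val < n → (a j).re - 1 < σ)

/-- `(2 π i)⁻¹ ∫ f(s) ds` along the line `Re s = σ` from `σ - i ∞` to `σ + i ∞`, where `f` is
the Mellin-Barnes integrand (`s = σ + i t`, `ds = i dt`). -/
noncomputable def meijerLineIntegral (m n : ℕ) {p q : ℕ} (a : Fin p → ℂ) (b : Fin q → ℂ)
    (z : ℂ) (σ : ℝ) : ℂ :=
  (2 * (Real.pi : ℂ))⁻¹ * ∫ t : ℝ, meijerIntegrand m n a b z (σ + t * Complex.I)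

open Classical in
/-- The Meijer function `G^{m,n}_{p,q}(z | a; b)`: the Mellin-Barnes integral along a vertical
line that separates the two families of poles (`0` by convention if there is no such line). -/
noncomputable def meijerG (m n : ℕ) {p q : ℕ} (a : Fin p → ℂ) (b : Fin q → ℂ) (z : ℂ) : ℂ :=
  if h : ∃ σ : ℝ, MeijerSeparates m n a b σ then meijerLineIntegral m n a b z h.choose else 0

/-- The value `meijerG m n a b z` is a genuine one: there is a separating line, the integral
converges absolutely on every such line, and its value does not depend on the line. -/
def MeijerGWellDefined (m n : ℕ) {p q : ℕ} (a : Fin p → ℂ) (b : Fin q → ℂ) (z : ℂ) : Prop :=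
  (∃ σ : ℝ, MeijerSeparates m n a b σ) ∧
  ∀ σ : ℝ, MeijerSeparates m n a b σ →
    Integrable (fun t : ℝ => meijerIntegrand m n a b z (σ + t * Complex.I)) ∧
    meijerLineIntegral m n a b z σ = meijerG m n a b z

end ShadowedScattering

/-!
A product of independent gamma and inverse-gamma variables `X` has moments `E[X ^ s]` that are, up
to a power of the rate, quotients of the factors `Γ(m + s)` and `Γ(α - s)` by their values at
`s = 0`. Exchanging two integrals shows that the cumulative distribution function of a positive
variable has Mellin transform `-E[X ^ s] / s` on `Re s < 0`. Mellin inversion along `Re s = -σ`,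
followed by `s ↦ -s`, recovers it as a Mellin-Barnes integral along `Re s = σ`. There
`1 / s = Γ(s) / Γ(1 + s)`, whence the parameters `1` and `0`, and the separating lines are exactly
those with `σ > 0` on which the moment of order `-σ` exists. Each such line therefore gives the same
value, and the integral converges absolutely because `Γ` decays at least quadratically on vertical
lines in the right half-plane.
-/

namespace ShadowedScattering

open MeasureTheory ProbabilityTheory Measure Set Filter Complex

section PositiveLaws

theorem ofReal_mul_cpow {x y : ℝ} (hx : 0 ≤ x) (hy : 0 ≤ y) (s : ℂ) :
    ((x * y : ℝ) : ℂ) ^ s = (x : ℂ) ^ s * (y : ℂ) ^ s := by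
  rw [ofReal_mul, mul_cpow_ofReal_nonneg hx hy]

theorem ofReal_inv_cpow {x : ℝ} (hx : 0 ≤ x) (s : ℂ) : ((x⁻¹ : ℝ) : ℂ) ^ s = (x : ℂ) ^ (-s) := by
  rw [ofReal_inv, inv_cpow _ _ (arg_ofReal_of_nonneg hx ▸ Real.pi_pos.ne), cpow_neg]

/-- The law `μ` has a complex moment of order `s`, equal to `v`; the integrability of `x ^ s` is
part of the notion, so that `v` is never a junk value. -/
def HasMoment (μ : Measure ℝ) (s v : ℂ) : Prop :=
  Integrable (fun x : ℝ => (x : ℂ) ^ s) μ ∧ ∫ x : ℝ, (x : ℂ) ^ s ∂μ = v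

variable {μ ν : Measure ℝ} {s v w : ℂ}

theorem HasMoment.mconv [SFinite μ] [SFinite ν] (hμ : ∀ᵐ x ∂μ, 0 < x) (hν : ∀ᵐ x ∂ν, 0 < x)
    (hv : HasMoment μ s v) (hw : HasMoment ν s w) : HasMoment (μ ∗ₘ ν) s (v * w) := by
  have hmul : (fun z : ℝ × ℝ => (z.1 : ℂ) ^ s * (z.2 : ℂ) ^ s) =ᵐ[μ.prod ν]
      fun z : ℝ × ℝ => ((z.1 * z.2 : ℝ) : ℂ) ^ s := by
    filter_upwards [quasiMeasurePreserving_fst.ae hμ, quasiMeasurePreserving_snd.ae hν]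
      with z h₁ h₂
    exact (ofReal_mul_cpow h₁.le h₂.le s).symm
  have hpow : Measurable fun x : ℝ => (x : ℂ) ^ s := by fun_prop
  unfold Measure.mconv HasMoment
  rw [integrable_map_measure hpow.aestronglyMeasurable (by fun_prop),
    integral_map (by fun_prop) hpow.aestronglyMeasurable, ← integral_congr_ae hmul,
    integral_prod_mul (fun x : ℝ => (x : ℂ) ^ s) fun x : ℝ => (x : ℂ) ^ s, hv.2, hw.2]
  exact ⟨(hv.1.mul_prod hw.1).congr hmul, rfl⟩

theorem HasMoment.map_inv (hμ : ∀ᵐ x ∂μ, 0 < x) (hv : HasMoment μ (-s) v) :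
    HasMoment (μ.map Inv.inv) s v := by
  have hinv : (fun x : ℝ => (x : ℂ) ^ (-s)) =ᵐ[μ] fun x : ℝ => ((x⁻¹ : ℝ) : ℂ) ^ s := by
    filter_upwards [hμ] with x hx
    exact (ofReal_inv_cpow hx.le s).symm
  have hpow : Measurable fun x : ℝ => (x : ℂ) ^ s := by fun_prop
  unfold HasMoment
  rw [integrable_map_measure hpow.aestronglyMeasurable (by fun_prop),
    integral_map (by fun_prop) hpow.aestronglyMeasurable, ← integral_congr_ae hinv]
  exact ⟨hv.1.congr hinv, hv.2⟩

theorem ae_pos_mconv [SFinite μ] [SFinite ν] (hμ : ∀ᵐ x ∂μ, 0 < x) (hν : ∀ᵐ x ∂ν, 0 < x) :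
    ∀ᵐ x ∂(μ ∗ₘ ν), 0 < x := by
  unfold Measure.mconv
  rw [ae_map_iff (by fun_prop) measurableSet_Ioi]
  filter_upwards [quasiMeasurePreserving_fst.ae hμ, quasiMeasurePreserving_snd.ae hν] with z h₁ h₂
  exact mul_pos h₁ h₂

theorem nullSingletonClass_mconv [SFinite ν] [NullSingletonClass ν] (hμ : ∀ᵐ x ∂μ, x ≠ 0) :
    NullSingletonClass (μ ∗ₘ ν) where
  measure_singleton c := by
    have hmul : Measurable fun z : ℝ × ℝ => z.1 * z.2 := by fun_prop
    unfold Measure.mconv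
    rw [map_apply hmul (measurableSet_singleton c),
      measure_prod_null (hmul (measurableSet_singleton c))]
    filter_upwards [hμ] with x hx
    refine measure_mono_null (fun y hy => ?_) (measure_singleton (μ := ν) (c / x))
    exact (eq_div_iff hx).2 (mul_comm y x ▸ hy)

theorem nullSingletonClass_map_inv [NullSingletonClass μ] :
    NullSingletonClass (μ.map Inv.inv) where
  measure_singleton c := by
    rw [map_apply measurable_inv (measurableSet_singleton c)]
    refine measure_mono_null (fun x hx => ?_) (measure_singleton (μ := μ) c⁻¹)
    exact inv_eq_iff_eq_inv.1 hx

end PositiveLaws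

section MellinCdf

variable {μ : Measure ℝ} {s v : ℂ}

theorem continuousAt_cdf [IsProbabilityMeasure μ] [NullSingletonClass μ] (a : ℝ) :
    ContinuousAt (cdf μ) a := by
  rw [(monotone_cdf μ).continuousAt_iff_leftLim_eq_rightLim, StieltjesFunction.rightLim_eq]
  have h := measure_singleton (μ := μ) a
  rw [← measure_cdf μ, StieltjesFunction.measure_singleton, ENNReal.ofReal_eq_zero] at h
  exact le_antisymm ((monotone_cdf μ).leftLim_le le_rfl) (by linarith)

/-- The kernel `x ^ (s - 1)` on `y ≤ x`, whose double integral over `x > 0` and a law in `y` is the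
Mellin transform of the cumulative distribution function in one order and a multiple of the moment
of order `s` in the other. -/
noncomputable def cdfMellinKernel (s : ℂ) (x y : ℝ) : ℂ :=
  (x : ℂ) ^ (s - 1) * (Iic x).indicator 1 y

theorem measurable_cdfMellinKernel (s : ℂ) : Measurable (Function.uncurry (cdfMellinKernel s)) := by
  have hpow : Measurable fun z : ℝ × ℝ => (z.1 : ℂ) ^ (s - 1) := by fun_prop
  exact hpow.mul (measurable_one.indicator (measurableSet_le measurable_snd measurable_fst))

theorem cdfMellinKernel_eq_indicator_Ici (s : ℂ) (y : ℝ) :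
    (fun x => cdfMellinKernel s x y) = (Ici y).indicator fun x : ℝ => (x : ℂ) ^ (s - 1) := by
  ext x
  by_cases h : y ≤ x <;> simp [cdfMellinKernel, h]

theorem integral_cdfMellinKernel_right [IsProbabilityMeasure μ] (s : ℂ) (x : ℝ) :
    ∫ y, cdfMellinKernel s x y ∂μ = (x : ℂ) ^ (s - 1) • ((cdf μ x : ℝ) : ℂ) := by
  simp only [cdfMellinKernel]
  rw [integral_const_mul, integral_indicator measurableSet_Iic, cdf_eq_real, smul_eq_mul]
  simp

theorem integrableOn_cdfMellinKernel_left (hs : s.re < 0) {y : ℝ} (hy : 0 < y) :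
    IntegrableOn (fun x => cdfMellinKernel s x y) (Ioi 0) := by
  rw [cdfMellinKernel_eq_indicator_Ici]
  refine (IntegrableOn.integrable_indicator ?_ measurableSet_Ici).integrableOn
  rw [integrableOn_Ici_iff_integrableOn_Ioi]
  exact integrableOn_Ioi_cpow_of_lt (by rw [sub_re, one_re]; linarith) hy

theorem integral_cdfMellinKernel_left (hs : s.re < 0) {y : ℝ} (hy : 0 < y) :
    ∫ x in Ioi 0, cdfMellinKernel s x y = -(y : ℂ) ^ s / s := by
  have hsub : Ici y ⊆ Ioi (0 : ℝ) := fun x hx => hy.trans_le hx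
  rw [cdfMellinKernel_eq_indicator_Ici, setIntegral_indicator measurableSet_Ici,
    inter_eq_right.2 hsub, integral_Ici_eq_integral_Ioi,
    integral_Ioi_cpow_of_lt (by rw [sub_re, one_re]; linarith) hy, sub_add_cancel]

theorem norm_cdfMellinKernel {x : ℝ} (hx : 0 < x) (s : ℂ) (y : ℝ) :
    (‖cdfMellinKernel s x y‖ : ℂ) = cdfMellinKernel s.re x y := by
  have hpow : (x : ℂ) ^ ((s.re : ℂ) - 1) = ((x ^ (s.re - 1) : ℝ) : ℂ) := by
    rw [ofReal_cpow hx.le]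
    push_cast
    rfl
  by_cases h : y ≤ x <;>
    simp [cdfMellinKernel, h, norm_cpow_eq_rpow_re_of_pos hx, hpow]

theorem integral_norm_cdfMellinKernel_left (hs : s.re < 0) {y : ℝ} (hy : 0 < y) :
    ∫ x in Ioi 0, ‖cdfMellinKernel s x y‖ = -‖(y : ℂ) ^ s‖ / s.re := by
  rw [← ofReal_inj, ← integral_complex_ofReal,
    setIntegral_congr_fun measurableSet_Ioi fun x hx => norm_cdfMellinKernel hx s y,
    integral_cdfMellinKernel_left (by simpa using hs) hy, norm_cpow_eq_rpow_re_of_pos hy]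
  push_cast
  rw [ofReal_cpow hy.le]

theorem integrable_cdfMellinKernel [SFinite μ] (hμ : ∀ᵐ x ∂μ, 0 < x) (hs : s.re < 0)
    (hint : Integrable (fun x : ℝ => (x : ℂ) ^ s) μ) :
    Integrable (Function.uncurry (cdfMellinKernel s)) ((volume.restrict (Ioi 0)).prod μ) := by
  rw [integrable_prod_iff' (measurable_cdfMellinKernel s).aestronglyMeasurable]
  constructor
  · filter_upwards [hμ] with y hy
    exact integrableOn_cdfMellinKernel_left hs hy
  · refine (hint.norm.neg.div_const s.re).congr ?_
    filter_upwards [hμ] with y hy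
    exact (integral_norm_cdfMellinKernel_left hs hy).symm

theorem hasMellin_cdf [IsProbabilityMeasure μ] (hμ : ∀ᵐ x ∂μ, 0 < x) (hs : s.re < 0)
    (hv : HasMoment μ s v) :
    HasMellin (fun x => ((cdf μ x : ℝ) : ℂ)) s (-v / s) := by
  have hint := integrable_cdfMellinKernel hμ hs hv.1
  refine ⟨hint.integral_prod_left.congr (ae_of_all _ (integral_cdfMellinKernel_right s)), ?_⟩
  calc mellin (fun x => ((cdf μ x : ℝ) : ℂ)) s
      = ∫ x in Ioi 0, ∫ y, cdfMellinKernel s x y ∂μ := by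
        simp only [integral_cdfMellinKernel_right, mellin]
    _ = ∫ y, (∫ x in Ioi 0, cdfMellinKernel s x y) ∂μ := integral_integral_swap hint
    _ = ∫ y : ℝ, -(y : ℂ) ^ s / s ∂μ := integral_congr_ae <| by
        filter_upwards [hμ] with y hy
        exact integral_cdfMellinKernel_left hs hy
    _ = -v / s := by rw [integral_div, integral_neg, hv.2]

theorem cdf_eq_mellinInv [IsProbabilityMeasure μ] [NullSingletonClass μ]
    (hμ : ∀ᵐ x ∂μ, 0 < x) {σ : ℝ} (hσ : σ < 0) {M : ℂ → ℂ}
    (hM : ∀ s : ℂ, s.re = σ → HasMoment μ s (M s))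
    (hint : VerticalIntegrable (fun s => -M s / s) σ) {x : ℝ} (hx : 0 < x) :
    ((cdf μ x : ℝ) : ℂ) = mellinInv σ (fun s => -M s / s) x := by
  have hmellin (t : ℝ) : HasMellin (fun x => ((cdf μ x : ℝ) : ℂ)) (σ + t * I)
      (-M (σ + t * I) / (σ + t * I)) :=
    hasMellin_cdf hμ (by simpa using hσ) (hM _ (by simp))
  have hinv := mellinInv_mellin_eq σ (fun x => ((cdf μ x : ℝ) : ℂ)) hx
    (by simpa using (hmellin 0).1) (hint.congr (ae_of_all _ fun t => (hmellin t).2.symm))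
    (continuous_ofReal.continuousAt.comp (continuousAt_cdf x))
  rw [← hinv]
  simp only [mellinInv, (hmellin _).2]

theorem mellinInv_neg {E : Type*} [NormedAddCommGroup E] [NormedSpace ℂ E] (σ : ℝ) (f : ℂ → E)
    (x : ℝ) :
    mellinInv (-σ) f x =
      (1 / (2 * Real.pi)) • ∫ t : ℝ, (x : ℂ) ^ (σ + t * I) • f (-(σ + t * I)) := by
  rw [mellinInv, ← integral_neg_eq_self]
  congr! 4 with t
  all_goals push_cast; ring_nf

end MellinCdf

section GammaBounds

theorem norm_Gamma_le_Gamma_re {s : ℂ} (hs : 0 < s.re) : ‖Gamma s‖ ≤ Real.Gamma s.re := by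
  rw [Gamma_eq_integral hs, Real.Gamma_eq_integral hs, GammaIntegral]
  refine (norm_integral_le_integral_norm _).trans_eq ?_
  refine setIntegral_congr_fun measurableSet_Ioi fun x hx => ?_
  simp only [norm_mul, norm_cpow_eq_rpow_re_of_pos hx, norm_real, Real.norm_eq_abs, Real.abs_exp,
    sub_re, one_re]

/-- The functional equation trades a shift of the argument by two for quadratic decay. -/
theorem norm_Gamma_le_div_sq {s : ℂ} (hs : 0 < s.re) :
    ‖Gamma s‖ ≤ Real.Gamma (s.re + 2) / ‖s‖ ^ 2 := by
  have hs₀ : s ≠ 0 := ne_of_apply_ne re hs.ne'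
  have hs₁ : s + 1 ≠ 0 := ne_of_apply_ne re (by simpa using (by positivity : s.re + 1 ≠ 0))
  have hle : ‖s‖ ≤ ‖s + 1‖ := by
    rw [norm_def, norm_def, normSq_apply, normSq_apply]
    refine Real.sqrt_le_sqrt ?_
    simp only [add_re, one_re, add_im, one_im]
    nlinarith
  rw [le_div_iff₀ (by positivity)]
  calc ‖Gamma s‖ * ‖s‖ ^ 2 ≤ ‖Gamma s‖ * (‖s‖ * ‖s + 1‖) := by rw [sq]; gcongr
    _ = ‖Gamma (s + 2)‖ := by
      rw [show s + 2 = s + 1 + 1 by ring, Gamma_add_one _ hs₁, Gamma_add_one _ hs₀, norm_mul,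
        norm_mul]
      ring
    _ ≤ Real.Gamma (s.re + 2) := by
      simpa using norm_Gamma_le_Gamma_re (s := s + 2) (by simpa using by positivity)

theorem continuous_Gamma_verticalLine {a : ℝ} (ha : 0 < a) :
    Continuous fun t : ℝ => Gamma (a + t * I) := by
  refine continuous_iff_continuousAt.2 fun t => ContinuousAt.comp (g := Gamma) ?_ (by fun_prop)
  refine (differentiableAt_Gamma _ fun n => ne_of_apply_ne re ?_).continuousAt
  simpa using (by linarith [n.cast_nonneg (α := ℝ)] : a ≠ -n)

theorem integrable_inv_sq_add_sq {a : ℝ} (ha : a ≠ 0) :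
    Integrable fun t : ℝ => (a ^ 2 + t ^ 2)⁻¹ := by
  refine ((integrable_inv_one_add_sq.comp_div ha).const_mul (a ^ 2)⁻¹).congr
    (ae_of_all _ fun t => ?_)
  simp only [← mul_inv]
  congr 1
  field_simp

theorem verticalIntegrable_Gamma {a : ℝ} (ha : 0 < a) : VerticalIntegrable Gamma a := by
  refine ((integrable_inv_sq_add_sq ha.ne').const_mul (Real.Gamma (a + 2))).mono'
    (continuous_Gamma_verticalLine ha).aestronglyMeasurable (ae_of_all _ fun t => ?_)
  have hbound := norm_Gamma_le_div_sq (s := a + t * I) (by simpa using ha)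
  rwa [Complex.sq_norm, normSq_add_mul_I, div_eq_mul_inv, add_re, ofReal_re, re_ofReal_mul, I_re,
    mul_zero, add_zero] at hbound

theorem integrable_prod_Gamma {ι : Type*} {S : Finset ι} (hS : S.Nonempty) {a ε : ι → ℝ}
    (ha : ∀ i ∈ S, 0 < a i) (hε : ∀ i ∈ S, ε i ≠ 0) :
    Integrable fun t : ℝ => ∏ i ∈ S, Gamma (a i + (ε i * t : ℝ) * I) := by
  have hfactor (i) (hi : i ∈ S) : Integrable fun t : ℝ => Gamma (a i + (ε i * t : ℝ) * I) :=
    Integrable.comp_mul_left' (verticalIntegrable_Gamma (ha i hi)) (hε i hi)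
  induction hS using Finset.Nonempty.cons_induction with
  | singleton i => simpa using hfactor i
  | cons i S hi _ ih =>
    simp only [Finset.prod_cons]
    simp only [Finset.mem_cons, forall_eq_or_imp] at ha hε hfactor
    refine (ih ha.2 hε.2 hfactor.2).bdd_mul (c := Real.Gamma (a i))
      hfactor.1.aestronglyMeasurable (ae_of_all _ fun t => ?_)
    simpa using norm_Gamma_le_Gamma_re (s := a i + (ε i * t : ℝ) * I) (by simpa using ha.1)

end GammaBounds

section GammaLaws

theorem measurable_gammaPDF (a r : ℝ) : Measurable (gammaPDF a r) :=
  (measurable_gammaPDFReal a r).ennreal_ofReal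

theorem integral_gammaMeasure {a r : ℝ} {E : Type*} [NormedAddCommGroup E] [NormedSpace ℝ E]
    (ha : 0 < a) (hr : 0 < r) (f : ℝ → E) :
    ∫ x, f x ∂gammaMeasure a r =
      ∫ x in Ioi 0, (r ^ a / Real.Gamma a * x ^ (a - 1) * Real.exp (-(r * x))) • f x := by
  unfold gammaMeasure
  rw [integral_withDensity_eq_integral_toReal_smul (measurable_gammaPDF a r)
      (ae_of_all _ fun _ => ENNReal.ofReal_lt_top),
    ← integral_Ici_eq_integral_Ioi, ← integral_indicator measurableSet_Ici]
  refine integral_congr_ae (ae_of_all _ fun x => ?_)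
  dsimp only
  by_cases hx : 0 ≤ x
  · rw [gammaPDF, ENNReal.toReal_ofReal (gammaPDFReal_nonneg ha hr x), gammaPDFReal, if_pos hx,
      indicator_of_mem (mem_Ici.2 hx)]
  · rw [gammaPDF_of_neg (not_le.1 hx), indicator_of_notMem (by simpa using hx), ENNReal.toReal_zero,
      zero_smul]

theorem ae_pos_gammaMeasure (a r : ℝ) : ∀ᵐ x ∂gammaMeasure a r, 0 < x := by
  unfold gammaMeasure
  rw [ae_withDensity_iff (measurable_gammaPDF a r)]
  filter_upwards [ae_ne volume 0] with x hx₀ hx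
  refine hx₀.symm.lt_of_le (not_lt.1 fun hneg => hx (gammaPDF_of_neg hneg))

theorem hasMoment_gammaMeasure {a r : ℝ} (ha : 0 < a) (hr : 0 < r) {s : ℂ}
    (hs : 0 < a + s.re) :
    HasMoment (gammaMeasure a r) s ((r : ℂ) ^ (-s) * (Gamma (a + s) / Gamma a)) := by
  have hre : 0 < (a + s).re := by simpa using hs
  have hr₀ : (r : ℂ) ≠ 0 := ofReal_ne_zero.2 hr.ne'
  have hra : (r : ℂ) ^ (a : ℂ) ≠ 0 := by simp [cpow_eq_zero_iff, hr₀]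
  have hΓ : Gamma (a : ℂ) ≠ 0 := Gamma_ne_zero_of_re_pos (by simpa using ha)
  have hdensity : ∀ x ∈ Ioi (0 : ℝ),
      (r ^ a / Real.Gamma a * x ^ (a - 1) * Real.exp (-(r * x))) • (x : ℂ) ^ s =
        (r : ℂ) ^ (a : ℂ) / Gamma a * ((x : ℂ) ^ (a + s - 1) * cexp (-(r * x))) := by
    intro x (hx : 0 < x)
    rw [add_sub_right_comm, cpow_add _ _ (ofReal_ne_zero.2 hx.ne'), Gamma_ofReal, real_smul]
    push_cast [ofReal_cpow hr.le, ofReal_cpow hx.le]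
    ring
  have hvalue : ∫ x : ℝ, (x : ℂ) ^ s ∂gammaMeasure a r =
      (r : ℂ) ^ (-s) * (Gamma (a + s) / Gamma a) := by
    rw [integral_gammaMeasure ha hr, setIntegral_congr_fun measurableSet_Ioi hdensity,
      integral_const_mul, integral_cpow_mul_exp_neg_mul_Ioi hre hr, one_div, ← ofReal_inv,
      ofReal_inv_cpow hr.le, neg_add, cpow_add _ _ hr₀, cpow_neg _ (a : ℂ)]
    field_simp
  refine ⟨Integrable.of_integral_ne_zero ?_, hvalue⟩
  rw [hvalue]
  exact mul_ne_zero (by simp [cpow_eq_zero_iff, hr₀])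
    (div_ne_zero (Gamma_ne_zero_of_re_pos hre) hΓ)

theorem map_inv_withDensity (f : ℝ → ENNReal) :
    (volume.withDensity f).map Inv.inv =
      volume.withDensity fun y => ENNReal.ofReal (y ^ 2)⁻¹ * f y⁻¹ := by
  ext B hB
  have himage : Inv.inv '' (B \ {0}) = Inv.inv ⁻¹' B \ {(0 : ℝ)} := by
    ext x
    simp [image_inv_eq_inv]
  rw [map_apply measurable_inv hB, withDensity_apply _ (measurable_inv hB), withDensity_apply _ hB,
    ← setLIntegral_congr (sdiff_null_ae_eq_self (measure_singleton 0)), ← himage,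
    ← setLIntegral_congr (sdiff_null_ae_eq_self (s := B) (measure_singleton 0)),
    lintegral_image_eq_lintegral_abs_deriv_mul (hB.diff (measurableSet_singleton 0))
      (fun x hx => (hasDerivAt_inv hx.2).hasDerivWithinAt) inv_injective.injOn]
  simp only [abs_neg, abs_inv, abs_sq]

theorem invGammaMeasure_eq_map_inv_gammaMeasure (α g : ℝ) :
    invGammaMeasure α g = (gammaMeasure α g).map Inv.inv := by
  unfold gammaMeasure invGammaMeasure
  rw [map_inv_withDensity]
  congr! with y
  rcases lt_trichotomy y 0 with hy | rfl | hy
  · rw [gammaPDF_of_neg (inv_lt_zero.2 hy), invGammaPDFReal, if_neg hy.not_gt, ENNReal.ofReal_zero,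
      mul_zero]
  · simp [invGammaPDFReal]
  · rw [gammaPDF_of_nonneg (inv_nonneg.2 hy.le), ← ENNReal.ofReal_mul (by positivity),
      invGammaPDFReal, if_pos hy, Real.inv_rpow hy.le, Real.rpow_add hy, Real.rpow_sub hy]
    congr 1
    simp only [Real.rpow_one, div_eq_mul_inv]
    field_simp

end GammaLaws

section GammaProducts

/-- The moment of order `s` of `c⁻¹ ∏ X / ∏ Y`, where the independent variables `X` and `Y` have
gamma laws of rate one and shapes in `m` and in `α` respectively. -/
noncomputable def gammaProductMoment (m α : Multiset ℝ) (c : ℝ) (s : ℂ) : ℂ :=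
  (c : ℂ) ^ (-s) * (m.map fun a : ℝ => Gamma (a + s) / Gamma a).prod *
    (α.map fun a : ℝ => Gamma (a - s) / Gamma a).prod

/-- `μ` is the law of a product of independent gamma variables, with shapes in `m`, and
inverse-gamma variables, with shapes in `α`, where `c > 0` is the product of the rates of the former
divided by that of the scales of the latter. The law is described by its complex moments. -/
structure IsGammaProductLaw (μ : Measure ℝ) (m α : Multiset ℝ) (c : ℝ) : Prop where
  isProbabilityMeasure : IsProbabilityMeasure μ
  nullSingletonClass : NullSingletonClass μ
  ae_pos : ∀ᵐ x ∂μ, 0 < x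
  rate_pos : 0 < c
  hasMoment : ∀ s : ℂ, (∀ a ∈ m, 0 < a + s.re) → (∀ a ∈ α, 0 < a - s.re) →
    HasMoment μ s (gammaProductMoment m α c s)

namespace IsGammaProductLaw

variable {μ ν : Measure ℝ} {m α m₁ m₂ α₁ α₂ : Multiset ℝ} {c c₁ c₂ : ℝ}

theorem mconv (hμ : IsGammaProductLaw μ m₁ α₁ c₁) (hν : IsGammaProductLaw ν m₂ α₂ c₂) :
    IsGammaProductLaw (μ ∗ₘ ν) (m₁ + m₂) (α₁ + α₂) (c₁ * c₂) := by
  have := hμ.isProbabilityMeasure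
  have := hν.isProbabilityMeasure
  have := hν.nullSingletonClass
  refine ⟨inferInstance, nullSingletonClass_mconv (hμ.ae_pos.mono fun _ => ne_of_gt),
    ae_pos_mconv hμ.ae_pos hν.ae_pos, mul_pos hμ.rate_pos hν.rate_pos, fun s hm hα => ?_⟩
  simp only [Multiset.mem_add, or_imp, forall_and] at hm hα
  convert (hμ.hasMoment s hm.1 hα.1).mconv hμ.ae_pos hν.ae_pos (hν.hasMoment s hm.2 hα.2) using 1
  simp only [gammaProductMoment, Multiset.map_add, Multiset.prod_add,
    ofReal_mul_cpow hμ.rate_pos.le hν.rate_pos.le]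
  ring

theorem map_inv (hμ : IsGammaProductLaw μ m α c) :
    IsGammaProductLaw (μ.map Inv.inv) α m c⁻¹ := by
  have := hμ.isProbabilityMeasure
  have := hμ.nullSingletonClass
  refine ⟨isProbabilityMeasure_map (by fun_prop), nullSingletonClass_map_inv, ?_,
    inv_pos.2 hμ.rate_pos, fun s hα hm => ?_⟩
  · rw [ae_map_iff (by fun_prop) measurableSet_Ioi]
    exact hμ.ae_pos.mono fun _ => inv_pos.2
  · convert (hμ.hasMoment (-s) (by simpa only [neg_re, ← sub_eq_add_neg] using hm)
      (by simpa only [neg_re, sub_neg_eq_add] using hα)).map_inv hμ.ae_pos using 1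
    simp only [gammaProductMoment, ofReal_inv_cpow hμ.rate_pos.le, sub_neg_eq_add, ← sub_eq_add_neg]
    ring

variable {S : Type*} [MeasurableSpace S] {P : Measure S} {X Y : S → ℝ}

theorem of_hasLaw (hμ : IsGammaProductLaw μ m α c) (hX : HasLaw X μ P) :
    IsGammaProductLaw (P.map X) m α c :=
  hX.map_eq ▸ hμ

theorem aemeasurable (hX : IsGammaProductLaw (P.map X) m α c) : AEMeasurable X P :=
  have := hX.isProbabilityMeasure
  .of_map_ne_zero (IsProbabilityMeasure.ne_zero _)

theorem map_mul (hX : IsGammaProductLaw (P.map X) m₁ α₁ c₁)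
    (hY : IsGammaProductLaw (P.map Y) m₂ α₂ c₂) (hXY : IndepFun X Y P) :
    IsGammaProductLaw (P.map fun ω => X ω * Y ω) (m₁ + m₂) (α₁ + α₂) (c₁ * c₂) := by
  have := hX.isProbabilityMeasure
  have := hY.isProbabilityMeasure
  have hmap : P.map (fun ω => X ω * Y ω) = P.map X ∗ₘ P.map Y :=
    hXY.map_mul_eq_map_mconv_map₀' hX.aemeasurable hY.aemeasurable inferInstance inferInstance
  exact hmap ▸ hX.mconv hY

theorem outageProbability_eq_cdf (hX : IsGammaProductLaw (P.map X) m α c) (γ : ℝ) :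
    outageProbability P X γ = cdf (P.map X) γ := by
  have := hX.isProbabilityMeasure
  rw [cdf_eq_real, map_measureReal_apply_of_aemeasurable hX.aemeasurable measurableSet_Iic]
  rfl

end IsGammaProductLaw

theorem isGammaProductLaw_gammaMeasure {a r : ℝ} (ha : 0 < a) (hr : 0 < r) :
    IsGammaProductLaw (gammaMeasure a r) {a} 0 r where
  isProbabilityMeasure := isProbabilityMeasure_gammaMeasure ha hr
  nullSingletonClass := by unfold gammaMeasure; infer_instance
  ae_pos := ae_pos_gammaMeasure a r
  rate_pos := hr
  hasMoment s hs _ := by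
    simpa [gammaProductMoment] using hasMoment_gammaMeasure ha hr (by simpa using hs)

theorem isGammaProductLaw_nakagamiSqMeasure {m Ω : ℝ} (hm : 0 < m) (hΩ : 0 < Ω) :
    IsGammaProductLaw (nakagamiSqMeasure m Ω) {m} 0 (m / Ω) := by
  rw [nakagamiSqMeasure_eq_gammaMeasure hm hΩ]
  exact isGammaProductLaw_gammaMeasure hm (div_pos hm hΩ)

theorem isGammaProductLaw_invGammaMeasure {α g : ℝ} (hα : 0 < α) (hg : 0 < g) :
    IsGammaProductLaw (invGammaMeasure α g) 0 {α} g⁻¹ := by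
  rw [invGammaMeasure_eq_map_inv_gammaMeasure]
  exact (isGammaProductLaw_gammaMeasure hα hg).map_inv

end GammaProducts

section MeijerFunction

theorem meijerG_eq_of_forall_line {m n p q : ℕ} {a : Fin p → ℂ} {b : Fin q → ℂ} {z v : ℂ}
    (hline : ∃ σ, MeijerSeparates m n a b σ)
    (hv : ∀ σ, MeijerSeparates m n a b σ → meijerLineIntegral m n a b z σ = v) :
    meijerG m n a b z = v :=
  (dif_pos hline).trans (hv _ hline.choose_spec)

variable {k l : ℕ}

/-- The upper parameters `1 - α₁, …, 1 - αₗ, 1` of the Meijer function of a product law with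
inverse-gamma shapes `α`. -/
noncomputable def upperParams (α : Fin l → ℝ) : Fin (l + 1) → ℂ :=
  Fin.snoc (α := fun _ => ℂ) (fun j => 1 - (α j : ℂ)) 1

/-- The lower parameters `m₁, …, mₖ, 0` of the Meijer function of a product law with gamma
shapes `m`. -/
noncomputable def lowerParams (m : Fin k → ℝ) : Fin (k + 1) → ℂ :=
  Fin.snoc (α := fun _ => ℂ) (fun i => (m i : ℂ)) 0

variable {m : Fin k → ℝ} {α : Fin l → ℝ} {σ : ℝ} {s z : ℂ}

theorem meijerSeparates_params_iff :
    MeijerSeparates k (l + 1) (upperParams α) (lowerParams m) σ ↔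
      (∀ i, σ < m i) ∧ (∀ j, 0 < α j + σ) ∧ 0 < σ := by
  simp [MeijerSeparates, upperParams, lowerParams, Fin.forall_fin_succ', neg_lt_iff_pos_add']

theorem exists_meijerSeparates_params (hm : ∀ i, 0 < m i) (hα : ∀ j, 0 < α j) :
    ∃ σ, MeijerSeparates k (l + 1) (upperParams α) (lowerParams m) σ := by
  have hsmall : ∀ᶠ σ in nhdsWithin 0 (Ioi (0 : ℝ)), ∀ i, σ < m i :=
    eventually_all.2 fun i => mem_nhdsWithin_of_mem_nhds (Iio_mem_nhds (hm i))
  obtain ⟨σ, hσm, hσ : 0 < σ⟩ := (hsmall.and self_mem_nhdsWithin).exists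
  exact ⟨σ, meijerSeparates_params_iff.2 ⟨hσm, fun j => add_pos (hα j) hσ, hσ⟩⟩

/-- The parameters `1` and `0` contribute `Γ(s) / Γ(1 + s) = 1 / s`. -/
theorem meijerIntegrand_params (hs : 0 < s.re) :
    meijerIntegrand k (l + 1) (upperParams α) (lowerParams m) z s =
      (∏ i, Gamma (m i - s)) * (∏ j, Gamma (α j + s)) * (z ^ s / s) := by
  have hs₀ : s ≠ 0 := ne_of_apply_ne re hs.ne'
  have hΓ : Gamma s ≠ 0 := Gamma_ne_zero_of_re_pos hs
  simp only [meijerIntegrand, upperParams, lowerParams, Fin.prod_univ_castSucc, Fin.snoc_castSucc,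
    Fin.snoc_last, Fin.val_castSucc, Fin.val_last, Fin.is_lt, lt_irrefl, if_true, if_false,
    sub_sub_cancel, sub_zero, sub_self, zero_add, add_comm 1 s, Gamma_add_one s hs₀]
  field_simp

theorem norm_cpow_div_le {x : ℝ} (hx : 0 < x) (hs : 0 < s.re) :
    ‖(x : ℂ) ^ s / s‖ ≤ x ^ s.re / s.re := by
  rw [norm_div, norm_cpow_eq_rpow_re_of_pos hx]
  gcongr
  exact re_le_norm s

theorem integrable_meijerIntegrand_params [Nonempty (Fin k ⊕ Fin l)] {x : ℝ} (hx : 0 < x)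
    (hσ : MeijerSeparates k (l + 1) (upperParams α) (lowerParams m) σ) :
    Integrable fun t : ℝ =>
      meijerIntegrand k (l + 1) (upperParams α) (lowerParams m) x (σ + t * I) := by
  obtain ⟨hσm, hσα, hσ₀⟩ := meijerSeparates_params_iff.1 hσ
  have hre (t : ℝ) : ((σ : ℂ) + t * I).re = σ := by simp
  have hGamma := integrable_prod_Gamma (S := Finset.univ) Finset.univ_nonempty
    (a := Sum.elim (fun i => m i - σ) fun j => α j + σ) (ε := Sum.elim (fun _ => -1) fun _ => 1)
    (by simpa using ⟨hσm, hσα⟩) (by simp)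
  have hpow : Measurable fun t : ℝ => (x : ℂ) ^ (σ + t * I) / (σ + t * I) := by fun_prop
  refine (hGamma.mul_bdd (c := x ^ σ / σ) hpow.aestronglyMeasurable (ae_of_all _ fun t => ?_)).congr
    (ae_of_all _ fun t => ?_) <;> beta_reduce
  · simpa only [hre] using norm_cpow_div_le hx (s := σ + t * I) (by simpa using hσ₀)
  · rw [meijerIntegrand_params (s := σ + t * I) (by simpa using hσ₀)]
    simp only [Fintype.prod_sum_type, Sum.elim_inl, Sum.elim_inr]
    congr! 4 <;> push_cast <;> ring

end MeijerFunction

section OutageProbability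

variable {k l : ℕ} {m : Fin k → ℝ} {α : Fin l → ℝ} {c γ σ : ℝ} {μ : Measure ℝ}

theorem prod_Gamma_mul_prod_Gamma_pos (hm : ∀ i, 0 < m i) (hα : ∀ j, 0 < α j) :
    0 < (∏ i, Real.Gamma (m i)) * ∏ j, Real.Gamma (α j) :=
  mul_pos (Finset.prod_pos fun i _ => Real.Gamma_pos_of_pos (hm i))
    (Finset.prod_pos fun j _ => Real.Gamma_pos_of_pos (hα j))

theorem meijerIntegrand_params_eq_gammaProductMoment (hm : ∀ i, 0 < m i) (hα : ∀ j, 0 < α j)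
    (hc : 0 ≤ c) (hγ : 0 ≤ γ) {s : ℂ} (hs : 0 < s.re) :
    meijerIntegrand k (l + 1) (upperParams α) (lowerParams m) ((c * γ : ℝ) : ℂ) s =
      ((∏ i, Real.Gamma (m i)) * ∏ j, Real.Gamma (α j) : ℝ) * ((γ : ℂ) ^ s *
        (gammaProductMoment (Finset.univ.val.map m) (Finset.univ.val.map α) c (-s) / s)) := by
  have hΓm : ∏ i, Gamma (m i : ℂ) ≠ 0 :=
    Finset.prod_ne_zero_iff.2 fun i _ => Gamma_ne_zero_of_re_pos (hm i)
  have hΓα : ∏ j, Gamma (α j : ℂ) ≠ 0 :=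
    Finset.prod_ne_zero_iff.2 fun j _ => Gamma_ne_zero_of_re_pos (hα j)
  rw [meijerIntegrand_params hs, ofReal_mul_cpow hc hγ]
  simp only [gammaProductMoment, Multiset.map_map, Function.comp_def, Finset.prod_map_val,
    Finset.prod_div_distrib, neg_neg, sub_neg_eq_add, ← sub_eq_add_neg, ofReal_mul, ofReal_prod,
    ← Gamma_ofReal]
  field_simp

theorem verticalIntegrable_gammaProductMoment_div [Nonempty (Fin k ⊕ Fin l)]
    (hm : ∀ i, 0 < m i) (hα : ∀ j, 0 < α j) (hc : 0 < c)
    (hσ : MeijerSeparates k (l + 1) (upperParams α) (lowerParams m) σ) :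
    VerticalIntegrable (fun s =>
      -gammaProductMoment (Finset.univ.val.map m) (Finset.univ.val.map α) c s / s) (-σ) := by
  have hσ₀ : 0 < σ := (meijerSeparates_params_iff.1 hσ).2.2
  have hΓ : (((∏ i, Real.Gamma (m i)) * ∏ j, Real.Gamma (α j) : ℝ) : ℂ) ≠ 0 :=
    ofReal_ne_zero.2 (prod_Gamma_mul_prod_Gamma_pos hm hα).ne'
  refine ((integrable_meijerIntegrand_params hc hσ).comp_neg.const_mul
    (((∏ i, Real.Gamma (m i)) * ∏ j, Real.Gamma (α j) : ℝ) : ℂ)⁻¹).congr (ae_of_all _ fun t => ?_)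
  have hintegrand := meijerIntegrand_params_eq_gammaProductMoment hm hα hc.le zero_le_one
    (s := σ + (-t : ℝ) * I) (by simpa using hσ₀)
  rw [mul_one, ofReal_one, one_cpow, one_mul] at hintegrand
  have hneg : ((-σ : ℝ) : ℂ) + t * I = -(σ + (-t : ℝ) * I) := by push_cast; ring
  beta_reduce
  rw [hintegrand, inv_mul_cancel_left₀ hΓ, hneg, neg_div_neg_eq]

namespace IsGammaProductLaw

variable (hμ : IsGammaProductLaw μ (Finset.univ.val.map m) (Finset.univ.val.map α) c)
include hμ

theorem meijerLineIntegral_eq [Nonempty (Fin k ⊕ Fin l)] (hm : ∀ i, 0 < m i) (hα : ∀ j, 0 < α j)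
    (hγ : 0 < γ) (hσ : MeijerSeparates k (l + 1) (upperParams α) (lowerParams m) σ) :
    meijerLineIntegral k (l + 1) (upperParams α) (lowerParams m) ((c * γ : ℝ) : ℂ) σ =
      ((∏ i, Real.Gamma (m i)) * ∏ j, Real.Gamma (α j) : ℝ) * ((cdf μ γ : ℝ) : ℂ) := by
  have := hμ.isProbabilityMeasure
  have := hμ.nullSingletonClass
  obtain ⟨hσm, hσα, hσ₀⟩ := meijerSeparates_params_iff.1 hσ
  have hmoment (s : ℂ) (hs : s.re = -σ) := hμ.hasMoment s
    (by simpa [hs, ← sub_eq_add_neg] using hσm) (by simpa [hs] using hσα)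
  have hintegrand (t : ℝ) :=
    meijerIntegrand_params_eq_gammaProductMoment hm hα hμ.rate_pos.le hγ.le (s := σ + t * I)
      (by simpa using hσ₀)
  rw [cdf_eq_mellinInv hμ.ae_pos (neg_lt_zero.2 hσ₀) hmoment
    (verticalIntegrable_gammaProductMoment_div hm hα hμ.rate_pos hσ) hγ, mellinInv_neg]
  simp only [meijerLineIntegral, hintegrand, integral_const_mul, neg_div_neg_eq, smul_eq_mul,
    real_smul]
  push_cast
  ring

theorem meijerGWellDefined [Nonempty (Fin k ⊕ Fin l)] (hm : ∀ i, 0 < m i) (hα : ∀ j, 0 < α j)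
    (hγ : 0 < γ) :
    MeijerGWellDefined k (l + 1) (upperParams α) (lowerParams m) ((c * γ : ℝ) : ℂ) := by
  have hexists := exists_meijerSeparates_params hm hα
  have hline (σ : ℝ) := hμ.meijerLineIntegral_eq hm hα hγ (σ := σ)
  refine ⟨hexists, fun σ hσ => ⟨?_, ?_⟩⟩
  · exact integrable_meijerIntegrand_params (mul_pos hμ.rate_pos hγ) hσ
  · exact (hline σ hσ).trans (meijerG_eq_of_forall_line hexists hline).symm

theorem ofReal_cdf_eq_meijerG [Nonempty (Fin k ⊕ Fin l)] (hm : ∀ i, 0 < m i)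
    (hα : ∀ j, 0 < α j) (hγ : 0 < γ) :
    ((cdf μ γ : ℝ) : ℂ) = (1 / ((∏ i, Real.Gamma (m i)) * ∏ j, Real.Gamma (α j)) : ℝ) *
      meijerG k (l + 1) (upperParams α) (lowerParams m) ((c * γ : ℝ) : ℂ) := by
  rw [meijerG_eq_of_forall_line (exists_meijerSeparates_params hm hα)
      fun _ => hμ.meijerLineIntegral_eq hm hα hγ,
    ← mul_assoc, ← ofReal_mul, one_div_mul_cancel (prod_Gamma_mul_prod_Gamma_pos hm hα).ne',
    ofReal_one, one_mul]

end IsGammaProductLaw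

section ShadowedFading

variable {m₁ m₂ α₁ α₂ : ℝ}

theorem lowerParams_pair (m₁ m₂ : ℝ) : lowerParams ![m₁, m₂] = ![(m₁ : ℂ), (m₂ : ℂ), 0] := by
  ext i
  fin_cases i <;> rfl

theorem upperParams_singleton (α : ℝ) : upperParams ![α] = ![1 - (α : ℂ), 1] := by
  ext i
  fin_cases i <;> rfl

theorem upperParams_pair (α₁ α₂ : ℝ) :
    upperParams ![α₁, α₂] = ![1 - (α₁ : ℂ), 1 - (α₂ : ℂ), 1] := by
  ext i
  fin_cases i <;> rfl

theorem IsGammaProductLaw.meijerG_two_three (hμ : IsGammaProductLaw μ {m₁, m₂} {α₁, α₂} c)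
    (hm₁ : 0 < m₁) (hm₂ : 0 < m₂) (hα₁ : 0 < α₁) (hα₂ : 0 < α₂) (hγ : 0 < γ) :
    MeijerGWellDefined 2 3 ![1 - (α₂ : ℂ), 1 - (α₁ : ℂ), 1] ![(m₁ : ℂ), (m₂ : ℂ), 0]
        ((c * γ : ℝ) : ℂ) ∧
      ((cdf μ γ : ℝ) : ℂ) =
        ((1 / (Real.Gamma m₁ * Real.Gamma m₂ * Real.Gamma α₁ * Real.Gamma α₂) : ℝ) : ℂ) *
          meijerG 2 3 ![1 - (α₂ : ℂ), 1 - (α₁ : ℂ), 1] ![(m₁ : ℂ), (m₂ : ℂ), 0]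
            ((c * γ : ℝ) : ℂ) := by
  have hm : ∀ i, 0 < ![m₁, m₂] i := by simp [Fin.forall_fin_two, hm₁, hm₂]
  have hα : ∀ j, 0 < ![α₂, α₁] j := by simp [Fin.forall_fin_two, hα₁, hα₂]
  rw [Multiset.pair_comm α₁] at hμ
  have hcdf := ofReal_cdf_eq_meijerG hμ hm hα hγ
  rw [Fin.prod_univ_two, Fin.prod_univ_two] at hcdf
  rw [mul_assoc (_ * _), mul_comm (Real.Gamma α₁), ← upperParams_pair, ← lowerParams_pair]
  exact ⟨meijerGWellDefined hμ hm hα hγ, hcdf⟩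

theorem IsGammaProductLaw.meijerG_two_two {α : ℝ} (hμ : IsGammaProductLaw μ {m₁, m₂} {α} c)
    (hm₁ : 0 < m₁) (hm₂ : 0 < m₂) (hα : 0 < α) (hγ : 0 < γ) :
    MeijerGWellDefined 2 2 ![1 - (α : ℂ), 1] ![(m₁ : ℂ), (m₂ : ℂ), 0] ((c * γ : ℝ) : ℂ) ∧
      ((cdf μ γ : ℝ) : ℂ) = ((1 / (Real.Gamma m₁ * Real.Gamma m₂ * Real.Gamma α) : ℝ) : ℂ) *
        meijerG 2 2 ![1 - (α : ℂ), 1] ![(m₁ : ℂ), (m₂ : ℂ), 0] ((c * γ : ℝ) : ℂ) := by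
  have hm : ∀ i, 0 < ![m₁, m₂] i := by simp [Fin.forall_fin_two, hm₁, hm₂]
  have hα' : ∀ j, 0 < ![α] j := by simp [hα]
  have hcdf := ofReal_cdf_eq_meijerG hμ hm hα' hγ
  rw [Fin.prod_univ_two, Fin.prod_univ_one] at hcdf
  rw [← upperParams_singleton, ← lowerParams_pair]
  exact ⟨meijerGWellDefined hμ hm hα' hγ, hcdf⟩

end ShadowedFading

end OutageProbability

end ShadowedScattering

open MeasureTheory ProbabilityTheory ShadowedScattering in
theorem mainTheorem4_general {S : Type*} [MeasurableSpace S] (P : Measure S)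
    (m₁ m₂ Ω : ℝ) (hm₁ : 0 < m₁) (hm₂ : 0 < m₂) (hΩ : 0 < Ω) :
    (∀ (α₁ α₂ g₁ g₂ : ℝ) (N₁ N₂ I₁ I₂ : S → ℝ),
      0 < α₁ → 0 < α₂ → 0 < g₁ → 0 < g₂ →
      HasLaw (fun ω => N₁ ω ^ 2) (nakagamiSqMeasure m₁ Ω) P →
      HasLaw (fun ω => N₂ ω ^ 2) (nakagamiSqMeasure m₂ Ω) P →
      HasLaw I₁ (invGammaMeasure α₁ g₁) P →
      HasLaw I₂ (invGammaMeasure α₂ g₂) P →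
      IndepFun (fun ω => N₁ ω ^ 2) I₁ P →
      IndepFun (fun ω => N₂ ω ^ 2) I₂ P →
      IndepFun (fun ω => N₁ ω ^ 2 * I₁ ω) (fun ω => N₂ ω ^ 2 * I₂ ω) P →
      ∀ γ : ℝ, 0 < γ →
        outageProbability P (fun ω => (N₁ ω ^ 2 * I₁ ω) * (N₂ ω ^ 2 * I₂ ω)) γ =
          cdf (P.map fun ω => (N₁ ω ^ 2 * I₁ ω) * (N₂ ω ^ 2 * I₂ ω)) γ ∧
        MeijerGWellDefined 2 3 ![1 - (α₂ : ℂ), 1 - (α₁ : ℂ), 1] ![(m₁ : ℂ), (m₂ : ℂ), 0]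
          ((m₁ * m₂ / (Ω ^ 2 * g₁ * g₂) * γ : ℝ) : ℂ) ∧
        ((cdf (P.map fun ω => (N₁ ω ^ 2 * I₁ ω) * (N₂ ω ^ 2 * I₂ ω)) γ : ℝ) : ℂ) =
          ((1 / (Real.Gamma m₁ * Real.Gamma m₂ * Real.Gamma α₁ * Real.Gamma α₂) : ℝ) : ℂ) *
            meijerG 2 3 ![1 - (α₂ : ℂ), 1 - (α₁ : ℂ), 1] ![(m₁ : ℂ), (m₂ : ℂ), 0]
              ((m₁ * m₂ / (Ω ^ 2 * g₁ * g₂) * γ : ℝ) : ℂ)) ∧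
    (∀ (α g : ℝ) (N₁ N₂ I : S → ℝ),
      0 < α → 0 < g →
      HasLaw (fun ω => N₁ ω ^ 2) (nakagamiSqMeasure m₁ Ω) P →
      HasLaw (fun ω => N₂ ω ^ 2) (nakagamiSqMeasure m₂ Ω) P →
      HasLaw I (invGammaMeasure α g) P →
      IndepFun (fun ω => N₁ ω ^ 2) (fun ω => N₂ ω ^ 2) P →
      IndepFun (fun ω => (N₁ ω * N₂ ω) ^ 2) I P →
      ∀ γ : ℝ, 0 < γ →
        outageProbability P (fun ω => (N₁ ω * N₂ ω) ^ 2 * I ω) γ =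
          cdf (P.map fun ω => (N₁ ω * N₂ ω) ^ 2 * I ω) γ ∧
        MeijerGWellDefined 2 2 ![1 - (α : ℂ), 1] ![(m₁ : ℂ), (m₂ : ℂ), 0]
          ((m₁ * m₂ / (Ω ^ 2 * g) * γ : ℝ) : ℂ) ∧
        ((cdf (P.map fun ω => (N₁ ω * N₂ ω) ^ 2 * I ω) γ : ℝ) : ℂ) =
          ((1 / (Real.Gamma m₁ * Real.Gamma m₂ * Real.Gamma α) : ℝ) : ℂ) *
            meijerG 2 2 ![1 - (α : ℂ), 1] ![(m₁ : ℂ), (m₂ : ℂ), 0]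
              ((m₁ * m₂ / (Ω ^ 2 * g) * γ : ℝ) : ℂ)) := by
  refine ⟨?_, ?_⟩
  · intro α₁ α₂ g₁ g₂ N₁ N₂ I₁ I₂ hα₁ hα₂ hg₁ hg₂ hN₁ hN₂ hI₁ hI₂ hNI₁ hNI₂ hM γ hγ
    have hM₁ := ((isGammaProductLaw_nakagamiSqMeasure hm₁ hΩ).of_hasLaw hN₁).map_mul
      ((isGammaProductLaw_invGammaMeasure hα₁ hg₁).of_hasLaw hI₁) hNI₁
    have hM₂ := ((isGammaProductLaw_nakagamiSqMeasure hm₂ hΩ).of_hasLaw hN₂).map_mul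
      ((isGammaProductLaw_invGammaMeasure hα₂ hg₂).of_hasLaw hI₂) hNI₂
    have hX : IsGammaProductLaw (P.map fun ω => (N₁ ω ^ 2 * I₁ ω) * (N₂ ω ^ 2 * I₂ ω))
        {m₁, m₂} {α₁, α₂} (m₁ * m₂ / (Ω ^ 2 * g₁ * g₂)) := by
      convert hM₁.map_mul hM₂ hM using 1
      exacts [by simp, by simp, by field_simp]
    exact ⟨hX.outageProbability_eq_cdf γ, hX.meijerG_two_three hm₁ hm₂ hα₁ hα₂ hγ⟩
  · intro α g N₁ N₂ I hα hg hN₁ hN₂ hI hN hNI γ hγ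
    have hN₁₂ := ((isGammaProductLaw_nakagamiSqMeasure hm₁ hΩ).of_hasLaw hN₁).map_mul
      ((isGammaProductLaw_nakagamiSqMeasure hm₂ hΩ).of_hasLaw hN₂) hN
    simp only [← mul_pow] at hN₁₂
    have hX : IsGammaProductLaw (P.map fun ω => (N₁ ω * N₂ ω) ^ 2 * I ω)
        {m₁, m₂} {α} (m₁ * m₂ / (Ω ^ 2 * g)) := by
      convert hN₁₂.map_mul ((isGammaProductLaw_invGammaMeasure hα hg).of_hasLaw hI) hNI using 1
      exacts [by simp, by simp, by field_simp]
    exact ⟨hX.outageProbability_eq_cdf γ, hX.meijerG_two_two hm₁ hm₂ hα hγ⟩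

open MeasureTheory ProbabilityTheory ShadowedScattering in
theorem mainTheorem4 {S : Type*} [MeasurableSpace S] (P : Measure S) [IsProbabilityMeasure P]
    (m₁ m₂ Ω : ℝ) (hm₁ : 0 < m₁) (hm₂ : 0 < m₂) (hΩ : 0 < Ω) :
    -- double shadowing
    (∀ (α₁ α₂ g₁ g₂ : ℝ) (N₁ N₂ I₁ I₂ : S → ℝ),
      1 < α₁ → 1 < α₂ → 0 < g₁ → 0 < g₂ →
      HasLaw (fun ω => N₁ ω ^ 2) (nakagamiSqMeasure m₁ Ω) P →
      HasLaw (fun ω => N₂ ω ^ 2) (nakagamiSqMeasure m₂ Ω) P →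
      HasLaw I₁ (invGammaMeasure α₁ g₁) P →
      HasLaw I₂ (invGammaMeasure α₂ g₂) P →
      IndepFun (fun ω => N₁ ω ^ 2) I₁ P →
      IndepFun (fun ω => N₂ ω ^ 2) I₂ P →
      IndepFun (fun ω => N₁ ω ^ 2 * I₁ ω) (fun ω => N₂ ω ^ 2 * I₂ ω) P →
      ∀ γ : ℝ, 0 < γ →
        outageProbability P (fun ω => (N₁ ω ^ 2 * I₁ ω) * (N₂ ω ^ 2 * I₂ ω)) γ =
          cdf (P.map fun ω => (N₁ ω ^ 2 * I₁ ω) * (N₂ ω ^ 2 * I₂ ω)) γ ∧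
        MeijerGWellDefined 2 3 ![1 - (α₂ : ℂ), 1 - (α₁ : ℂ), 1] ![(m₁ : ℂ), (m₂ : ℂ), 0]
          ((m₁ * m₂ / (Ω ^ 2 * g₁ * g₂) * γ : ℝ) : ℂ) ∧
        ((cdf (P.map fun ω => (N₁ ω ^ 2 * I₁ ω) * (N₂ ω ^ 2 * I₂ ω)) γ : ℝ) : ℂ) =
          ((1 / (Real.Gamma m₁ * Real.Gamma m₂ * Real.Gamma α₁ * Real.Gamma α₂) : ℝ) : ℂ) *
            meijerG 2 3 ![1 - (α₂ : ℂ), 1 - (α₁ : ℂ), 1] ![(m₁ : ℂ), (m₂ : ℂ), 0]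
              ((m₁ * m₂ / (Ω ^ 2 * g₁ * g₂) * γ : ℝ) : ℂ)) ∧
    -- single shadowing
    (∀ (α g : ℝ) (N₁ N₂ I : S → ℝ),
      1 < α → 0 < g →
      HasLaw (fun ω => N₁ ω ^ 2) (nakagamiSqMeasure m₁ Ω) P →
      HasLaw (fun ω => N₂ ω ^ 2) (nakagamiSqMeasure m₂ Ω) P →
      HasLaw I (invGammaMeasure α g) P →
      IndepFun (fun ω => N₁ ω ^ 2) (fun ω => N₂ ω ^ 2) P →
      IndepFun (fun ω => (N₁ ω * N₂ ω) ^ 2) I P →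
      ∀ γ : ℝ, 0 < γ →
        outageProbability P (fun ω => (N₁ ω * N₂ ω) ^ 2 * I ω) γ =
          cdf (P.map fun ω => (N₁ ω * N₂ ω) ^ 2 * I ω) γ ∧
        MeijerGWellDefined 2 2 ![1 - (α : ℂ), 1] ![(m₁ : ℂ), (m₂ : ℂ), 0]
          ((m₁ * m₂ / (Ω ^ 2 * g) * γ : ℝ) : ℂ) ∧
        ((cdf (P.map fun ω => (N₁ ω * N₂ ω) ^ 2 * I ω) γ : ℝ) : ℂ) =
          ((1 / (Real.Gamma m₁ * Real.Gamma m₂ * Real.Gamma α) : ℝ) : ℂ) *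
            meijerG 2 2 ![1 - (α : ℂ), 1] ![(m₁ : ℂ), (m₂ : ℂ), 0]
              ((m₁ * m₂ / (Ω ^ 2 * g) * γ : ℝ) : ℂ)) := by
  obtain ⟨hdouble, hsingle⟩ := mainTheorem4_general P m₁ m₂ Ω hm₁ hm₂ hΩ
  exact ⟨fun _ _ _ _ _ _ _ _ hα₁ hα₂ => hdouble _ _ _ _ _ _ _ _ (one_pos.trans hα₁)
    (one_pos.trans hα₂), fun _ _ _ _ _ hα => hsingle _ _ _ _ _ (one_pos.trans hα)⟩
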